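/- Consider the triangular lattice, drawn with horizontal lattice lines, with the following coordinates: one unit on the horizontal $i$-axis is half the side of a unit triangle, one unit on the vertical $j$-axis is the height of a unit triangle, and the lattice vertices are the integer points $(i,j)$ with $i+j$ odd. Let $x,n\ge 0$ be integers and let $1\le s_1<s_2<\dots<s_n\le n+x$ be integers. The quartered hexagon $R^2_x(s_1,\dots,s_n)$ is obtained from the right trapezoidal region with side-lengths $x,\,2n,\,x+n,\,2n$ (north, west, south, northeast) by removing $n$ up-pointing unit triangles along its base. Precisely, the trapezoidal region is bounded by the south side from $(1,0)$ to $(2(x+n)+1,0)$, the northeast side from there to $(2x+1,2n)$, the north side from $(2x+1,2n)$ to $(1,2n)$, and, on the west, the vertical zigzag through $(1,0),(0,1),(1,2),(0,3),\dots,(0,2n-1),(1,2n)$, which touches the $j$-axis; the removed triangles are those whose base edges join $(2s_i-1,0)$ to $(2s_i+1,0)$, $i=1,\dots,n$, i.e. the up-pointing unit triangles at positions $s_1,\dots,s_n$, from left to right, along the base. A lozenge is the union of two unit triangles sharing an edge; it is vertical if the shared edge is horizontal. Each vertical lozenge with center $(i,j)$ has weight $\operatorname{wt}_1(i,j)=\frac{q^{i}+q^{-i}}{2}$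 and every other lozenge has weight $1$, where $q$ is an indeterminate. The weight of a lozenge tiling is the product of the weights of its lozenges, and $\operatorname{M}(R^2_x(s_1,\dots,s_n))$ is the sum of the weights of all lozenge tilings of the region (the empty region, $n=0$, has exactly one tiling, of weight $1$). Write $[m]_q=1+q+\dots+q^{m-1}$ and $[m]_q!=[1]_q[2]_q\cdots[m]_q$. Then \begin{align*} \operatorname{M}(R^{2}_{x}(s_1,\dots,s_n)) &=2^{-n^2}q^{-\sum_{i=1}^n((4i-2)s_i-2i^2+i)}\,\frac{\prod_{i=1}^{n}[2s_i]_{q^2}\prod_{1\leq i<j\leq n}[2(s_i+s_j)]_{q^2}[2(s_j-s_i)]_{q^2}}{\prod_{i=1}^{n}[2i-1]_{q^2}!}\\ &=2^{-n^2}q^{-\sum_{i=1}^n((4i-2)s_i-2i^2+i)}\prod_{i=1}^{n}\frac{1}{q^{4s_i}+1}\prod_{1\leq i\leq j\leq n}\frac{[2(s_i+s_j)]_{q^2}}{[i+j-1]_{q^2}}\prod_{1\leq i<j\leq n}\frac{[2(s_j-s_i)]_{q^2}}{[j-i]_{q^2}}. \end{align*} -/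

import Mathlib

namespace QuarteredHexagon

/-!
Coordinates.  One unit on the horizontal `i`-axis is half the side of a unit triangle, one unit on
the vertical `j`-axis is the height of a unit triangle.  The lattice vertices are the integer
points `(i, j)` with `i + j` odd.  A unit triangle is recorded as `(c, r) : ℤ × ℤ`, where `c` is
the abscissa of its axis of symmetry and `r`, `r + 1` are the ordinates of the two horizontal lines
bounding it.  It is up-pointing if `c + r` is even and down-pointing if `c + r` is odd, and every
pair of integers is exactly one unit triangle.
-/

/-- The unit triangle `t` points up. -/
def IsUp (t : ℤ × ℤ) : Prop := Even (t.1 + t.2)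

instance : DecidablePred IsUp := fun t => inferInstanceAs (Decidable (Even (t.1 + t.2)))

/-- The three corners of a unit triangle. -/
def vertices (t : ℤ × ℤ) : Finset (ℤ × ℤ) :=
  if IsUp t then {(t.1 - 1, t.2), (t.1 + 1, t.2), (t.1, t.2 + 1)}
  else {(t.1 - 1, t.2 + 1), (t.1 + 1, t.2 + 1), (t.1, t.2)}

/-- A lozenge is the union of two unit triangles sharing an edge.  Such triangles have opposite
orientations; the lozenge is recorded as the pair (down-pointing half, up-pointing half). -/
def IsLozenge (l : (ℤ × ℤ) × (ℤ × ℤ)) : Prop :=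
  ¬ IsUp l.1 ∧ IsUp l.2 ∧ (vertices l.1 ∩ vertices l.2).card = 2

/-- A lozenge is vertical if its two halves share a horizontal edge, i.e. its up-pointing half
lies directly above its down-pointing half.  Its center has abscissa `l.1.1`. -/
def IsVertical (l : (ℤ × ℤ) × (ℤ × ℤ)) : Prop := l.2 = (l.1.1, l.1.2 + 1)

instance : DecidablePred IsVertical :=
  fun l => inferInstanceAs (Decidable (l.2 = (l.1.1, l.1.2 + 1)))

/-- `T` is a lozenge tiling of the region `R` (a finite set of unit triangles): all lozenges of `T`
lie in `R`, and every unit triangle of `R` belongs to exactly one of them. -/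
def IsTiling (R : Finset (ℤ × ℤ)) (T : Finset ((ℤ × ℤ) × (ℤ × ℤ))) : Prop :=
  (∀ l ∈ T, IsLozenge l ∧ l.1 ∈ R ∧ l.2 ∈ R) ∧
    ∀ t ∈ R, ∃! l : (ℤ × ℤ) × (ℤ × ℤ), l ∈ T ∧ (t = l.1 ∨ t = l.2)

open Classical in
/-- The finite set of all lozenge tilings of `R`. -/
noncomputable def tilings (R : Finset (ℤ × ℤ)) : Finset (Finset ((ℤ × ℤ) × (ℤ × ℤ))) :=
  (R ×ˢ R).powerset.filter (IsTiling R)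

/-- The symmetric weight: `(q ^ i + q ^ (-i)) / 2` for a vertical lozenge whose center has abscissa
`i`, and `1` for every other lozenge. -/
noncomputable def symWeight {K : Type*} [Field K] (q : K) (l : (ℤ × ℤ) × (ℤ × ℤ)) : K :=
  if IsVertical l then (q ^ l.1.1 + q ^ (-l.1.1)) / 2 else 1

/-- The tiling generating function of the region `R` under the symmetric weight. -/
noncomputable def tilingGF {K : Type*} [Field K] (q : K) (R : Finset (ℤ × ℤ)) : K :=
  ∑ T ∈ tilings R, ∏ l ∈ T, symWeight q l

/-- The right trapezoidal region with side lengths `x, 2n, x + n, 2n` (north, west, south,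
northeast): all unit triangles whose corners satisfy `0 ≤ i`, `0 ≤ j ≤ 2n` and
`i + j ≤ 2(x + n) + 1`.  The base goes from `(1, 0)` to `(2(x + n) + 1, 0)`, the north side from
`(1, 2n)` to `(2x + 1, 2n)`, and the west side is the zigzag
`(1, 0), (0, 1), (1, 2), (0, 3), …, (1, 2n)`, which touches the `j`-axis from the right. The product
of intervals is only a bounding box. -/
noncomputable def trapezoid (x n : ℕ) : Finset (ℤ × ℤ) :=
  (Finset.Icc (0 : ℤ) (2 * (x + n) + 1) ×ˢ Finset.Icc (0 : ℤ) (2 * n)).filter fun t =>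
    ∀ v ∈ vertices t, 0 ≤ v.1 ∧ 0 ≤ v.2 ∧ v.2 ≤ 2 * n ∧ v.1 + v.2 ≤ 2 * (x + n) + 1

/-- The shape of the quartered hexagon `R²_x(s_1, …, s_n)`: the up-pointing triangles at the
positions `s_1, …, s_n` along the base are removed.  The `p`-th up-pointing triangle on the base
(`p = 1, …, x + n`) has the base edge from `(2p - 1, 0)` to `(2p + 1, 0)`. -/
noncomputable def quarteredHexagon (x n : ℕ) (s : Fin n → ℕ) : Finset (ℤ × ℤ) :=
  trapezoid x n \ Finset.univ.image fun i => (2 * (s i : ℤ), (0 : ℤ))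

/-- The `q`-integer `[m]_q = 1 + q + ⋯ + q ^ (m - 1)`. -/
def qInt {K : Type*} [Field K] (q : K) (m : ℕ) : K := ∑ k ∈ Finset.range m, q ^ k

/-- The `q`-factorial `[m]_q! = [1]_q [2]_q ⋯ [m]_q`. -/
def qFactorial {K : Type*} [Field K] (q : K) (m : ℕ) : K :=
  ∏ k ∈ Finset.range m, qInt q (k + 1)

/-- The exponent `∑_{i=1}^n ((4i - 2) s_i - 2i² + i)`; the index `i` of the sum is `(i : Fin n) + 1`. -/
def qExponent (n : ℕ) (s : Fin n → ℕ) : ℤ :=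
  ∑ i : Fin n, ((4 * ((i : ℤ) + 1) - 2) * (s i : ℤ) - 2 * ((i : ℤ) + 1) ^ 2 + ((i : ℤ) + 1))

end QuarteredHexagon

/-!
Cut the region along the horizontal lines. The vertical lozenges crossing a line sit at dents of
the row above it, and the dents of two consecutive rows interlace, so a tiling is a chain of
interlacing tuples of columns, which gain one entry every second row. If the tilings of the rows
above a line, with dents in the columns `c 1 < ⋯ < c m`, have the generating function of a multiple
of a determinant `det (f k (c i))` with `f k` a combination of hyperbolic sines (or cosines), then
multiplication by the weights `cosh` and summation over the interlacing tuples is, by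
multilinearity, again such a determinant: the sums telescope, the `cosh` (or `sinh`) of the next
row being a sum of differences. Every determinant that occurs is a Vandermonde determinant in
`q ^ (2 * c) + q ^ (-2 * c)`, whose factors are the differences
`(q ^ (a + b) - q ^ (-a - b)) * (q ^ (a - b) - q ^ (b - a))`.
-/

namespace QuarteredHexagon

section Hyperbolic

variable {K : Type*} [Field K] (q : K)

/-- The hyperbolic cosine `q ^ k + q ^ (-k)`, without the factor `1 / 2`. -/
def qSum (k : ℤ) : K := q ^ k + q ^ (-k)

/-- The hyperbolic sine `q ^ k - q ^ (-k)`, without the factor `1 / 2`. -/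
def qDiff (k : ℤ) : K := q ^ k - q ^ (-k)

@[simp]
theorem qSum_zero : qSum q 0 = 2 := by
  norm_num [qSum]

@[simp]
theorem qDiff_zero : qDiff q 0 = 0 := by
  simp [qDiff]

theorem qSum_neg (k : ℤ) : qSum q (-k) = qSum q k := by
  rw [qSum, qSum, neg_neg, add_comm]

variable {q}

theorem qSum_mul_qSum (hq : q ≠ 0) (a b : ℤ) :
    qSum q a * qSum q b = qSum q (b + a) + qSum q (b - a) := by
  simp only [qSum, neg_add, neg_sub, zpow_add₀ hq, zpow_sub₀ hq, zpow_neg]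
  field_simp
  ring

theorem qSum_mul_qDiff (hq : q ≠ 0) (a b : ℤ) :
    qSum q a * qDiff q b = qDiff q (b + a) + qDiff q (b - a) := by
  simp only [qSum, qDiff, neg_add, neg_sub, zpow_add₀ hq, zpow_sub₀ hq, zpow_neg]
  field_simp
  ring

theorem qDiff_mul_qSum (hq : q ≠ 0) (a b : ℤ) :
    qDiff q a * qSum q b = qDiff q (b + a) - qDiff q (b - a) := by
  simp only [qSum, qDiff, neg_add, neg_sub, zpow_add₀ hq, zpow_sub₀ hq, zpow_neg]
  field_simp
  ring

theorem qDiff_mul_qDiff (hq : q ≠ 0) (a b : ℤ) :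
    qDiff q a * qDiff q b = qSum q (b + a) - qSum q (b - a) := by
  simp only [qSum, qDiff, neg_add, neg_sub, zpow_add₀ hq, zpow_sub₀ hq, zpow_neg]
  field_simp
  ring

theorem qSum_mul_qDiff_self (hq : q ≠ 0) (a : ℤ) : qSum q a * qDiff q a = qDiff q (2 * a) := by
  rw [qSum_mul_qDiff hq, sub_self, qDiff_zero, add_zero, two_mul]

end Hyperbolic

section Tilings

variable {K : Type*} [Field K] (q : K) {R : Finset (ℤ × ℤ)} {T : Finset ((ℤ × ℤ) × (ℤ × ℤ))}
  {l : (ℤ × ℤ) × (ℤ × ℤ)} {t : ℤ × ℤ} {c r : ℤ}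

theorem isLozenge_iff {d u : ℤ × ℤ} :
    IsLozenge (d, u) ↔
      ¬ IsUp d ∧ (u = (d.1 - 1, d.2) ∨ u = (d.1 + 1, d.2) ∨ u = (d.1, d.2 + 1)) := by
  obtain ⟨a, b⟩ := d
  obtain ⟨c, e⟩ := u
  constructor
  · rintro ⟨hd, hu, hcard⟩
    obtain ⟨v, w, hvw, h⟩ := Finset.card_eq_two.mp hcard
    have hv : v ∈ vertices (a, b) ∩ vertices (c, e) := by simp [h]
    have hw : w ∈ vertices (a, b) ∩ vertices (c, e) := by simp [h]
    simp only [vertices, hd, hu, if_false, if_true, Finset.mem_inter, Finset.mem_insert,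
      Finset.mem_singleton] at hv hw
    grind
  · rintro ⟨hd, h⟩
    have hu : IsUp (c, e) := by
      simp only [IsUp] at hd ⊢
      grind
    refine ⟨hd, hu, Finset.card_eq_two.mpr ?_⟩
    simp only [vertices, hd, hu, if_false, if_true]
    rcases h with h | h | h <;> obtain ⟨rfl, rfl⟩ := Prod.mk.inj h
    · exact ⟨(a - 1, e + 1), (a, e), by grind, by grind⟩
    · exact ⟨(a + 1, e + 1), (a, e), by grind, by grind⟩
    · exact ⟨(c - 1, b + 1), (c + 1, b + 1), by grind, by grind⟩

theorem mem_tilings : T ∈ tilings R ↔ IsTiling R T := by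
  simp only [tilings, Finset.mem_filter, Finset.mem_powerset, and_iff_right_iff_imp]
  exact fun h l hl => Finset.mem_product.mpr (h.1 l hl).2

theorem IsTiling.erase (hT : IsTiling R T) (hl : l ∈ T) :
    IsTiling (R \ {l.1, l.2}) (T.erase l) := by
  refine ⟨fun m hm => ?_, fun t ht => ?_⟩
  · obtain ⟨hne, hmT⟩ := Finset.mem_erase.mp hm
    obtain ⟨hm, h1, h2⟩ := hT.1 m hmT
    have disjoint : ∀ t ∈ R, (t = m.1 ∨ t = m.2) → ¬ (t = l.1 ∨ t = l.2) := fun t ht h h' =>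
      hne ((hT.2 t ht).unique ⟨hmT, h⟩ ⟨hl, h'⟩)
    exact ⟨hm, by simpa [h1] using disjoint m.1 h1, by simpa [h2] using disjoint m.2 h2⟩
  · simp only [Finset.mem_sdiff, Finset.mem_insert, Finset.mem_singleton] at ht
    obtain ⟨m, ⟨hmT, hm⟩, huniq⟩ := hT.2 t ht.1
    refine ⟨m, ⟨Finset.mem_erase.mpr ⟨?_, hmT⟩, hm⟩, fun m' hm' =>
      huniq m' ⟨Finset.mem_of_mem_erase hm'.1, hm'.2⟩⟩
    rintro rfl
    exact ht.2 hm

theorem IsTiling.notMem_of_sdiff (hT : IsTiling (R \ {l.1, l.2}) T) : l ∉ T := fun h => by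
  simpa using (hT.1 l h).2.1

theorem IsTiling.insert (hT : IsTiling (R \ {l.1, l.2}) T) (hl : IsLozenge l)
    (h1 : l.1 ∈ R) (h2 : l.2 ∈ R) : IsTiling R (insert l T) := by
  refine ⟨fun m hm => ?_, fun t ht => ?_⟩
  · rcases Finset.mem_insert.mp hm with rfl | hm
    · exact ⟨hl, h1, h2⟩
    · exact (hT.1 m hm).imp_right (.imp (Finset.sdiff_subset ·) (Finset.sdiff_subset ·))
  · by_cases h : t = l.1 ∨ t = l.2
    · refine ⟨l, ⟨Finset.mem_insert_self _ _, h⟩, fun m ⟨hm, _⟩ => ?_⟩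
      refine (Finset.mem_insert.mp hm).resolve_right fun hm => ?_
      have := hT.1 m hm
      grind
    · obtain ⟨m, ⟨hmT, hm⟩, huniq⟩ := hT.2 t (by simpa [ht] using h)
      refine ⟨m, ⟨Finset.mem_insert_of_mem hmT, hm⟩, fun m' ⟨hm', hmt⟩ => ?_⟩
      rcases Finset.mem_insert.mp hm' with rfl | hm'
      · exact absurd hmt h
      · exact huniq m' ⟨hm', hmt⟩

theorem sum_tilings_filter_mem (hl : IsLozenge l) (h1 : l.1 ∈ R) (h2 : l.2 ∈ R) :
    ∑ T ∈ tilings R with l ∈ T, ∏ m ∈ T, symWeight q m =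
      symWeight q l * tilingGF q (R \ {l.1, l.2}) := by
  rw [tilingGF, Finset.mul_sum]
  refine Finset.sum_bij' (fun T _ => T.erase l) (fun T _ => insert l T) ?_ ?_ ?_ ?_ ?_ <;>
    simp only [Finset.mem_filter, mem_tilings]
  · exact fun T hT => hT.1.erase hT.2
  · exact fun T hT => ⟨hT.insert hl h1 h2, Finset.mem_insert_self _ _⟩
  · exact fun T hT => Finset.insert_erase hT.2
  · exact fun T hT => Finset.erase_insert hT.notMem_of_sdiff
  · exact fun T hT => (Finset.mul_prod_erase T _ hT.2).symm

theorem tilingGF_eq_sum_lozenges (ht : t ∈ R) {S : Finset ((ℤ × ℤ) × (ℤ × ℤ))}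
    (hS : ∀ l, l ∈ S ↔ IsLozenge l ∧ l.1 ∈ R ∧ l.2 ∈ R ∧ (t = l.1 ∨ t = l.2)) :
    tilingGF q R = ∑ l ∈ S, symWeight q l * tilingGF q (R \ {l.1, l.2}) := by
  have cover_unique : ∀ T ∈ tilings R, ({l ∈ S | l ∈ T}).card = 1 := by
    intro T hT
    rw [mem_tilings] at hT
    obtain ⟨l, ⟨hlT, htl⟩, huniq⟩ := hT.2 t ht
    refine Finset.card_eq_one.mpr ⟨l, Finset.ext fun m => ?_⟩
    simp only [Finset.mem_filter, Finset.mem_singleton, hS]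
    refine ⟨fun h => huniq m ⟨h.2, h.1.2.2.2⟩, ?_⟩
    rintro rfl
    obtain ⟨hm, h1, h2⟩ := hT.1 m hlT
    exact ⟨⟨hm, h1, h2, htl⟩, hlT⟩
  calc tilingGF q R = ∑ T ∈ tilings R, ∑ l ∈ S with l ∈ T, ∏ m ∈ T, symWeight q m :=
        Finset.sum_congr rfl fun T hT => by rw [Finset.sum_const, cover_unique T hT, one_smul]
    _ = ∑ l ∈ S, ∑ T ∈ tilings R with l ∈ T, ∏ m ∈ T, symWeight q m :=
        Finset.sum_comm' fun T l => by simp only [Finset.mem_filter]; tauto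
    _ = _ := Finset.sum_congr rfl fun l hl =>
        have ⟨h, h1, h2, _⟩ := (hS l).mp hl
        sum_tilings_filter_mem q h h1 h2

theorem tilingGF_empty : tilingGF q ∅ = 1 := by
  have h : tilings ∅ = {∅} := by
    ext T
    rw [mem_tilings, Finset.mem_singleton]
    refine ⟨fun h => Finset.eq_empty_of_forall_notMem fun l hl => by simpa using (h.1 l hl).2.1, ?_⟩
    rintro rfl
    exact ⟨by simp, by simp⟩
  simp [tilingGF, h]

theorem symWeight_vertical : symWeight q ((c, r), (c, r + 1)) = qSum q c / 2 := by
  simp [symWeight, IsVertical, qSum]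

theorem symWeight_horizontal {c' : ℤ} : symWeight q ((c, r), (c', r)) = 1 := by
  simp [symWeight, IsVertical]

theorem tilingGF_eq_of_down (h : (c, r) ∈ R) (hd : Odd (c + r)) :
    tilingGF q R =
      (if (c - 1, r) ∈ R then tilingGF q (R \ {(c, r), (c - 1, r)}) else 0) +
      (if (c + 1, r) ∈ R then tilingGF q (R \ {(c, r), (c + 1, r)}) else 0) +
      if (c, r + 1) ∈ R then qSum q c / 2 * tilingGF q (R \ {(c, r), (c, r + 1)}) else 0 := by
  have hd' : ¬ IsUp (c, r) := by simpa [IsUp] using hd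
  rw [tilingGF_eq_sum_lozenges q h (S := Finset.filter (·.2 ∈ R) {((c, r), (c - 1, r)),
    ((c, r), (c + 1, r)), ((c, r), (c, r + 1))}), Finset.sum_filter,
    Finset.sum_insert (by grind), Finset.sum_pair (by grind)]
  · simp only [symWeight_horizontal, symWeight_vertical, one_mul, add_assoc]
  · rintro ⟨d, u⟩
    simp only [Finset.mem_filter, Finset.mem_insert, Finset.mem_singleton, isLozenge_iff, IsUp]
      at hd' ⊢
    grind

theorem tilingGF_eq_of_up (h : (c, r) ∈ R) (hu : Even (c + r)) :
    tilingGF q R =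
      (if (c - 1, r) ∈ R then tilingGF q (R \ {(c - 1, r), (c, r)}) else 0) +
      (if (c + 1, r) ∈ R then tilingGF q (R \ {(c + 1, r), (c, r)}) else 0) +
      if (c, r - 1) ∈ R then qSum q c / 2 * tilingGF q (R \ {(c, r - 1), (c, r)}) else 0 := by
  rw [tilingGF_eq_sum_lozenges q h (S := Finset.filter (·.1 ∈ R) {((c - 1, r), (c, r)),
    ((c + 1, r), (c, r)), ((c, r - 1), (c, r))}), Finset.sum_filter,
    Finset.sum_insert (by grind), Finset.sum_pair (by grind)]
  · have vertical : symWeight q ((c, r - 1), (c, r)) = qSum q c / 2 := by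
      simpa using symWeight_vertical q (r := r - 1)
    simp only [symWeight_horizontal, vertical, one_mul, add_assoc]
  · rintro ⟨d, u⟩
    simp only [Finset.mem_filter, Finset.mem_insert, Finset.mem_singleton, isLozenge_iff, IsUp]
    grind

end Tilings

section Columns

/-- The columns `a + 1, a + 3, a + 5, …` that are smaller than `b`. -/
noncomputable def colsBetween (a b : ℤ) : Finset ℤ :=
  (Finset.Ioo a b).filter fun c => Odd (c - a)

variable {M : Type*} [AddCommMonoid M] {a b c : ℤ}

theorem mem_colsBetween : c ∈ colsBetween a b ↔ a < c ∧ c < b ∧ Odd (c - a) := by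
  simp only [colsBetween, Finset.mem_filter, Finset.mem_Ioo, and_assoc]

theorem eq_sum_colsBetween_add {f g : ℤ → M} (hab : a ≤ b) (heven : Even (b - a))
    (step : ∀ c, a ≤ c → c < b → Even (c - a) → f c = g (c + 1) + f (c + 2)) :
    f a = ∑ c ∈ colsBetween a b, g c + f b := by
  obtain ⟨L, rfl⟩ : ∃ L : ℕ, a = b - 2 * L := ⟨((b - a) / 2).toNat, by grind⟩
  clear hab heven
  induction L with
  | zero => simp [colsBetween]
  | succ L ih =>
    have split : colsBetween (b - 2 * (L + 1 : ℕ)) b =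
        insert (b - 2 * (L + 1 : ℕ) + 1) (colsBetween (b - 2 * L) b) := by
      ext c
      grind [mem_colsBetween]
    rw [step _ le_rfl (by grind) (by simp), split, Finset.sum_insert (by grind [mem_colsBetween]),
      show b - 2 * (L + 1 : ℕ) + 2 = b - 2 * L by grind, add_assoc,
      ih fun c h1 h2 h3 => step c (by grind) h2 (by grind)]

theorem eq_of_forall_eq_add_two {f : ℤ → M} (hab : a ≤ b) (heven : Even (b - a))
    (step : ∀ c, a ≤ c → c < b → Even (c - a) → f c = f (c + 2)) : f a = f b := by
  simpa using eq_sum_colsBetween_add (f := f) (g := fun _ => 0) hab heven (by simpa using step)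

end Columns

section Rows

/-- The triangles `(c, r)` with `1 ≤ c` and `c + r ≤ N` in the rows `r, …, H - 1`, without the
columns `≤ c` and those in `A` in row `r`, and without the columns in `V` in row `r + 1`.  This is
what is left to tile once the columns `≤ c` of row `r` are covered, if `V` is the set of columns of
the vertical lozenges used so far. -/
noncomputable def rowRegion (N H r : ℤ) (A : Finset ℤ) (c : ℤ) (V : Finset ℤ) : Finset (ℤ × ℤ) :=
  (Finset.Icc 1 (N - r) ×ˢ Finset.Ico r H).filter fun t =>
    t.1 + t.2 ≤ N ∧ (t.2 = r → c < t.1 ∧ t.1 ∉ A) ∧ (t.2 = r + 1 → t.1 ∉ V)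

variable {K : Type*} [Field K] (q : K) {N H r a b c : ℤ} {A V : Finset ℤ}

theorem mem_rowRegion {t : ℤ × ℤ} :
    t ∈ rowRegion N H r A c V ↔ 1 ≤ t.1 ∧ r ≤ t.2 ∧ t.2 < H ∧ t.1 + t.2 ≤ N ∧
      (t.2 = r → c < t.1 ∧ t.1 ∉ A) ∧ (t.2 = r + 1 → t.1 ∉ V) := by
  simp only [rowRegion, Finset.mem_filter, Finset.mem_product, Finset.mem_Icc, Finset.mem_Ico]
  grind

theorem rowRegion_of_mem (h : c + 1 ∈ A) :
    rowRegion N H r A c V = rowRegion N H r A (c + 1) V := by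
  ext t
  grind [mem_rowRegion]

theorem rowRegion_sdiff_horizontal :
    rowRegion N H r A c V \ {(c + 1, r), (c + 2, r)} = rowRegion N H r A (c + 2) V := by
  ext t
  grind [mem_rowRegion]

theorem rowRegion_sdiff_vertical :
    rowRegion N H r A c V \ {(c + 1, r), (c + 1, r + 1)} =
      rowRegion N H r A (c + 1) (insert (c + 1) V) := by
  ext t
  grind [mem_rowRegion]

theorem rowRegion_of_add_eq (hc : c + r = N) :
    rowRegion N H r A c V = rowRegion N H (r + 1) V 0 ∅ := by
  ext t
  grind [mem_rowRegion]

theorem tilingGF_rowRegion_up (hrH : r < H) (hc : 0 ≤ c) (hpar : Odd (c + r))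
    (h1 : c + 1 ∉ A) (hle : c + 1 + r ≤ N) :
    tilingGF q (rowRegion N H r A c V) =
      if c + 2 ∉ A ∧ c + 2 + r ≤ N then tilingGF q (rowRegion N H r A (c + 2) V) else 0 := by
  have left : (c + 1 - 1, r) ∉ rowRegion N H r A c V := by simp [mem_rowRegion]
  have right : (c + 1 + 1, r) ∈ rowRegion N H r A c V ↔ c + 2 ∉ A ∧ c + 2 + r ≤ N := by
    grind [mem_rowRegion]
  have below : (c + 1, r - 1) ∉ rowRegion N H r A c V := by simp [mem_rowRegion]
  rw [tilingGF_eq_of_up q (c := c + 1) (r := r) (by grind [mem_rowRegion]) (by grind),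
    if_neg left, if_neg below, if_congr right rfl rfl, zero_add, add_zero, Finset.pair_comm,
    ← rowRegion_sdiff_horizontal, add_assoc c 1 1, one_add_one_eq_two]

theorem tilingGF_rowRegion_down (hrH : r < H) (hc : 0 ≤ c) (hpar : Even (c + r))
    (h1 : c + 1 ∉ A) (hV : c + 1 ∉ V) (hle : c + 2 + r ≤ N) :
    tilingGF q (rowRegion N H r A c V) =
      (if c + 2 ∈ A then 0 else tilingGF q (rowRegion N H r A (c + 2) V)) +
      if r + 1 < H then
        qSum q (c + 1) / 2 * tilingGF q (rowRegion N H r A (c + 1) (insert (c + 1) V)) else 0 := by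
  have left : (c + 1 - 1, r) ∉ rowRegion N H r A c V := by simp [mem_rowRegion]
  have right : (c + 1 + 1, r) ∈ rowRegion N H r A c V ↔ ¬ c + 2 ∈ A := by
    grind [mem_rowRegion]
  have above : (c + 1, r + 1) ∈ rowRegion N H r A c V ↔ r + 1 < H := by
    grind [mem_rowRegion]
  rw [tilingGF_eq_of_down q (c := c + 1) (r := r) (by grind [mem_rowRegion]) (by grind),
    if_neg left, if_congr right rfl rfl, if_congr above rfl rfl, zero_add, ite_not,
    rowRegion_sdiff_vertical, add_assoc c 1 1, one_add_one_eq_two, rowRegion_sdiff_horizontal]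

/-- The lozenges of row `r` up to the next removed triangle are forced. -/
theorem tilingGF_rowRegion_eq_of_odd (hrH : r < H) (hc : 0 ≤ c) (hpar : Odd (c + r))
    (hcb : c < b) (hb : b ∈ A) (hbpar : Even (b + r)) (hbN : b + r ≤ N)
    (hA : ∀ a ∈ A, c < a → b ≤ a) :
    tilingGF q (rowRegion N H r A c V) = tilingGF q (rowRegion N H r A b V) := by
  obtain ⟨d, rfl⟩ : ∃ d, b = d + 1 := ⟨b - 1, by simp⟩
  rw [← rowRegion_of_mem hb]
  refine eq_of_forall_eq_add_two (f := fun c => tilingGF q (rowRegion N H r A c V))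
    (by grind) (by grind) fun e h1 h2 h3 => ?_
  rw [tilingGF_rowRegion_up q hrH (by grind) (by grind) (by grind) (by grind), if_pos (by grind)]

/-- What is left of row `r` has one up-pointing triangle too many. -/
theorem tilingGF_rowRegion_eq_zero (hrH : r < H) (hc : 0 ≤ c) (hpar : Odd (c + r))
    (hN : Even N) (hcN : c + r < N) (hA : ∀ a ∈ A, a ≤ c) :
    tilingGF q (rowRegion N H r A c V) = 0 := by
  have last : tilingGF q (rowRegion N H r A (N - r - 1) V) = 0 := by
    rw [tilingGF_rowRegion_up q hrH (by grind) (by grind) (by grind) (by grind),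
      if_neg (by grind)]
  rw [← last]
  refine eq_of_forall_eq_add_two (f := fun c => tilingGF q (rowRegion N H r A c V))
    (by grind) (by grind) fun e h1 h2 h3 => ?_
  rw [tilingGF_rowRegion_up q hrH (by grind) (by grind) (by grind) (by grind), if_pos (by grind)]

theorem tilingGF_rowRegion_eq_succ (hrH : r < H) (hc : 0 ≤ c) (hpar : Even (c + r))
    (hN : Even N) (hcN : c + r ≤ N) (hA : ∀ a ∈ A, a ≤ c) (hV : ∀ v ∈ V, v ≤ c) :
    tilingGF q (rowRegion N H r A c V) = tilingGF q (rowRegion N H (r + 1) V 0 ∅) := by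
  rw [← rowRegion_of_add_eq (A := A) (sub_add_cancel N r)]
  refine eq_of_forall_eq_add_two (f := fun c => tilingGF q (rowRegion N H r A c V))
    (by grind) (by grind) fun e h1 h2 h3 => ?_
  rw [tilingGF_rowRegion_down q hrH (by grind) (by grind) (by grind) (by grind) (by grind),
    if_neg (by grind),
    tilingGF_rowRegion_eq_zero q (c := e + 1) hrH (by grind) (by grind) hN (by grind) (by grind),
    mul_zero, ite_self, add_zero]

theorem tilingGF_rowRegion_eq_sum_colsBetween (hrH : r + 1 < H) (ha : 0 ≤ a) (hapar : Even (a + r))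
    (hab : a < b) (hb : b ∈ A) (hbpar : Even (b + r)) (hbN : b + r ≤ N)
    (hA : ∀ c ∈ A, a < c → b ≤ c) (hV : ∀ v ∈ V, v ≤ a) :
    tilingGF q (rowRegion N H r A a V) =
      ∑ c ∈ colsBetween a b, qSum q c / 2 * tilingGF q (rowRegion N H r A b (insert c V)) := by
  have key := eq_sum_colsBetween_add
    (f := fun c => if c < b then tilingGF q (rowRegion N H r A c V) else 0)
    (g := fun c => qSum q c / 2 * tilingGF q (rowRegion N H r A b (insert c V)))
    hab.le (by grind) fun e h1 h2 h3 => ?_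
  · simpa [hab] using key
  have vertical : tilingGF q (rowRegion N H r A (e + 1) (insert (e + 1) V)) =
      tilingGF q (rowRegion N H r A b (insert (e + 1) V)) :=
    tilingGF_rowRegion_eq_of_odd q (by grind) (by grind) (by grind) (by grind) hb hbpar hbN
      (by grind)
  rw [if_pos h2, tilingGF_rowRegion_down q (by grind) (by grind) (by grind) (by grind) (by grind)
    (by grind), if_pos hrH, vertical, add_comm]
  congr 1
  by_cases hmem : e + 2 ∈ A
  · rw [if_pos hmem, if_neg (by grind)]
  · rw [if_neg hmem, if_pos (by grind)]

end Rows

section Interlacing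

/-- The tuples `d` that interlace `a`, i.e. `a 0 < d 0 < a 1 < d 1 < ⋯`, with `d i` and `a i` of
opposite parity. -/
noncomputable def interlacing {m : ℕ} (a : Fin (m + 1) → ℤ) : Finset (Fin m → ℤ) :=
  Fintype.piFinset fun i => colsBetween (a i.castSucc) (a i.succ)

theorem mem_interlacing {m : ℕ} {a : Fin (m + 1) → ℤ} {d : Fin m → ℤ} :
    d ∈ interlacing a ↔ ∀ i, a i.castSucc < d i ∧ d i < a i.succ ∧ Odd (d i - a i.castSucc) := by
  simp only [interlacing, Fintype.mem_piFinset, mem_colsBetween]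

theorem sum_interlacing_succ {M : Type*} [AddCommMonoid M] {m : ℕ} (a : Fin (m + 2) → ℤ)
    (f : (Fin (m + 1) → ℤ) → M) :
    ∑ d ∈ interlacing a, f d =
      ∑ c ∈ colsBetween (a 0) (a 1), ∑ d ∈ interlacing (Fin.tail a), f (Fin.cons c d) := by
  rw [← Finset.sum_product']
  refine Finset.sum_bij' (fun d _ => (d 0, Fin.tail d)) (fun p _ => Fin.cons p.1 p.2) ?_ ?_ ?_ ?_ ?_
    <;> simp [interlacing, Fintype.mem_piFinset, Fin.forall_fin_succ, Fin.tail]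

/-- The up-pointing triangles of row `r` in the columns `a` form an admissible set of dents of the
region `c + r ≤ N`.  Column `0` is allowed, since the rows of even height are bordered by it. -/
structure IsDentRow (N r : ℤ) {m : ℕ} (a : Fin m → ℤ) : Prop where
  strictMono : StrictMono a
  nonneg : ∀ i, 0 ≤ a i
  even : ∀ i, Even (a i + r)
  le : ∀ i, a i + r ≤ N

variable {N H r : ℤ} {m : ℕ}

theorem IsDentRow.of_mem_interlacing {a : Fin (m + 1) → ℤ} (ha : IsDentRow N r a) {d : Fin m → ℤ}
    (hd : d ∈ interlacing a) : IsDentRow N (r + 1) d := by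
  rw [mem_interlacing] at hd
  refine ⟨fun i j hij => ?_, fun i => ?_, fun i => ?_, fun i => ?_⟩
  · calc d i < a i.succ := (hd i).2.1
      _ ≤ a j.castSucc := ha.strictMono.monotone (Fin.succ_le_castSucc_iff.mpr hij)
      _ < d j := (hd j).1
  · exact (ha.nonneg _).trans (hd i).1.le
  · grind [hd i, ha.even i.castSucc]
  · grind [hd i, ha.le i.succ]

theorem IsDentRow.vecCons_zero_of_mem_interlacing {a : Fin (m + 1) → ℤ} (ha : IsDentRow N r a)
    (hr : Odd r) {d : Fin m → ℤ} (hd : d ∈ interlacing a) :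
    IsDentRow N (r + 1) (Matrix.vecCons 0 d) := by
  have hd' := ha.of_mem_interlacing hd
  have pos : ∀ i, 0 < d i := fun i => (ha.nonneg _).trans_lt (mem_interlacing.mp hd i).1
  have first : 1 + r ≤ N := by grind [ha.nonneg 0, ha.even 0, ha.le 0]
  refine ⟨?_, ?_, ?_, ?_⟩
  · exact Fin.strictMono_cons.mpr ⟨pos, hd'.strictMono⟩
  all_goals rw [Fin.forall_fin_succ]
  · exact ⟨le_rfl, hd'.nonneg⟩
  · exact ⟨by simpa using hr.add_one, hd'.even⟩
  · exact ⟨by simpa [add_comm] using first, hd'.le⟩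

theorem IsDentRow.tail {a : Fin (m + 1) → ℤ} (ha : IsDentRow N r a) :
    IsDentRow N r (Fin.tail a) :=
  ⟨ha.strictMono.comp Fin.strictMono_succ, fun _ => ha.nonneg _, fun _ => ha.even _,
    fun _ => ha.le _⟩

variable {K : Type*} [Field K] (q : K)

theorem tilingGF_rowRegion_eq_sum_interlacing {A : Finset ℤ} (hN : Even N) (hH : r + m < H)
    {a : Fin (m + 1) → ℤ} (ha : IsDentRow N r a) (hA : ∀ c, a 0 < c → (c ∈ A ↔ c ∈ Set.range a))
    {V : Finset ℤ} (hV : ∀ v ∈ V, v ≤ a 0) :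
    tilingGF q (rowRegion N H r A (a 0) V) =
      ∑ d ∈ interlacing a, (∏ i, qSum q (d i) / 2) *
        tilingGF q (rowRegion N H (r + 1) (V ∪ Finset.univ.image d) 0 ∅) := by
  induction m generalizing V with
  | zero =>
    have hA' : ∀ c ∈ A, c ≤ a 0 := by
      by_contra! ⟨c, hc, hlt⟩
      obtain ⟨i, rfl⟩ := (hA c hlt).mp hc
      exact hlt.ne (congrArg a (Fin.fin_one_eq_zero i).symm)
    rw [tilingGF_rowRegion_eq_succ q (by simpa using hH) (ha.nonneg 0) (ha.even 0) hN (ha.le 0) hA'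
      hV]
    simp [interlacing]
  | succ m ih =>
    have hlt : a 0 < a 1 := ha.strictMono Fin.zero_lt_one
    have hmin : ∀ c ∈ A, a 0 < c → a 1 ≤ c := by
      intro c hc hlt
      obtain ⟨i, rfl⟩ := (hA c hlt).mp hc
      exact ha.strictMono.monotone (Fin.one_le_of_ne_zero fun h => by simp [h] at hlt)
    have hA' : ∀ c, a 1 < c → (c ∈ A ↔ c ∈ Set.range (Fin.tail a)) := by
      intro c hc
      rw [hA c (hlt.trans hc), Fin.range_fin_succ, Set.mem_insert_iff,
        or_iff_right (hlt.trans hc).ne']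
    rw [tilingGF_rowRegion_eq_sum_colsBetween q (by grind) (ha.nonneg 0) (ha.even 0) hlt
      ((hA _ hlt).mpr ⟨1, rfl⟩) (ha.even 1) (ha.le 1) hmin hV, sum_interlacing_succ]
    refine Finset.sum_congr rfl fun c hc => ?_
    have hcV : ∀ v ∈ insert c V, v ≤ a 1 := by grind [mem_colsBetween]
    rw [show a 1 = Fin.tail a 0 from rfl, ih (by grind) ha.tail hA' hcV, Finset.mul_sum]
    refine Finset.sum_congr rfl fun d _ => ?_
    have image_cons : V ∪ Finset.univ.image (Fin.cons c d : Fin (m + 1) → ℤ) =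
        insert c V ∪ Finset.univ.image d := by
      ext v
      simp [Fin.exists_fin_succ, or_left_comm, eq_comm]
    rw [image_cons, Fin.prod_univ_succ, mul_assoc]
    simp only [Fin.cons_zero, Fin.cons_succ]

/-- The triangles `(c, j)` with `1 ≤ c` and `c + j ≤ N` in the rows `r, …, H - 1`, without the dents
`(a i, r)`. -/
noncomputable def dentedRegion (N H r : ℤ) (a : Fin m → ℤ) : Finset (ℤ × ℤ) :=
  rowRegion N H r (Finset.univ.image a) 0 ∅

theorem tilingGF_dentedRegion_of_even (hN : Even N) (hH : r + m < H) {a : Fin m → ℤ}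
    (ha : IsDentRow N r (Matrix.vecCons 0 a)) :
    tilingGF q (dentedRegion N H r a) = ∑ d ∈ interlacing (Matrix.vecCons 0 a),
      (∏ i, qSum q (d i) / 2) * tilingGF q (dentedRegion N H (r + 1) d) := by
  have dents : ∀ c, (0 : ℤ) < c →
      (c ∈ Finset.univ.image a ↔ c ∈ Set.range (Matrix.vecCons 0 a)) := by
    intro c hc
    simp [Matrix.range_cons, hc.ne']
  simpa [dentedRegion] using tilingGF_rowRegion_eq_sum_interlacing q hN hH ha dents (V := ∅)

theorem tilingGF_dentedRegion_of_odd (hN : Even N) (hr : Odd r) (hH : r + m < H)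
    {a : Fin (m + 1) → ℤ} (ha : IsDentRow N r a) :
    tilingGF q (dentedRegion N H r a) = ∑ d ∈ interlacing a,
      (∏ i, qSum q (d i) / 2) * tilingGF q (dentedRegion N H (r + 1) d) := by
  have hmin : ∀ c ∈ Finset.univ.image a, 0 < c → a 0 ≤ c := by
    simpa using fun i _ => ha.strictMono.monotone (Fin.zero_le i)
  rw [dentedRegion, tilingGF_rowRegion_eq_of_odd q (by grind) le_rfl (by simpa using hr)
    (by grind [ha.nonneg 0, ha.even 0]) (by simp) (ha.even 0) (ha.le 0) hmin,
    tilingGF_rowRegion_eq_sum_interlacing q hN hH ha (by simp) (by simp)]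
  simp [dentedRegion]

end Interlacing

section Determinants

open Polynomial Matrix

section CommRing

variable {R : Type*} [CommRing R] {m : ℕ}

/-- Chebyshev-type monic polynomials `p₀ = 1`, `p₁ = X + e`, `pₖ₊₂ = X pₖ₊₁ - dₖ pₖ`. They express
the hyperbolic sines and cosines of multiples of an argument through one hyperbolic cosine. -/
noncomputable def threeTermPoly (e : R) (d : ℕ → R) : ℕ → R[X]
  | 0 => 1
  | 1 => X + C e
  | k + 2 => X * threeTermPoly e d (k + 1) - C (d k) * threeTermPoly e d k

theorem threeTermPoly_monic_natDegree [Nontrivial R] (e : R) (d : ℕ → R) (k : ℕ) :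
    (threeTermPoly e d k).Monic ∧ (threeTermPoly e d k).natDegree = k := by
  induction k using Nat.twoStepInduction with
  | zero => exact ⟨monic_one, natDegree_one⟩
  | one => exact ⟨monic_X_add_C e, natDegree_X_add_C e⟩
  | more k ih ih' =>
    have hX := monic_X.mul ih'.1
    have hdeg : (X * threeTermPoly e d (k + 1)).natDegree = k + 2 := by
      rw [natDegree_X_mul ih'.1.ne_zero, ih'.2]
    have hlt : (C (d k) * threeTermPoly e d k).natDegree <
        (X * threeTermPoly e d (k + 1)).natDegree := by
      have := natDegree_C_mul_le (d k) (threeTermPoly e d k)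
      lia
    exact ⟨hX.sub_of_left (degree_lt_degree hlt),
      (natDegree_sub_eq_left_of_natDegree_lt hlt).trans hdeg⟩

theorem det_of_threeTermRecursion (A Y : Fin m → R) (h : ℕ → Fin m → R) (e : R) (d : ℕ → R)
    (h0 : ∀ i, h 0 i = A i) (h1 : ∀ i, h 1 i = A i * (Y i + e))
    (hrec : ∀ k i, h (k + 2) i = Y i * h (k + 1) i - d k * h k i) :
    (of fun i j : Fin m => h j i).det = (∏ i, A i) * (vandermonde Y).det := by
  nontriviality R
  have h_eval (k : ℕ) (i : Fin m) : h k i = A i * (threeTermPoly e d k).eval (Y i) := by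
    induction k using Nat.twoStepInduction with
    | zero => simp [threeTermPoly, h0]
    | one => simp [threeTermPoly, h1]
    | more k ih ih' =>
      rw [hrec, ih, ih']
      simp only [threeTermPoly, eval_sub, eval_mul, eval_X, eval_C]
      ring
  have h_monic (k : ℕ) := threeTermPoly_monic_natDegree e d k
  rw [det_eval_matrixOfPolynomials_eq_det_vandermonde Y (fun j => threeTermPoly e d j)
    (fun j => (h_monic j).2) (fun j => (h_monic j).1), ← det_mul_column]
  simp only [of_apply, h_eval]

theorem det_consecutive_differences (G : Fin (m + 1) → Fin m → R) :
    (of fun i k : Fin m => G i.succ k - G i.castSucc k).det =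
      (of fun i => (Fin.cons 1 (G i) : Fin (m + 1) → R)).det := by
  symm
  rw [det_eq_of_forall_row_eq_smul_add_pred (B := of fun i => Fin.cases (Fin.cons 1 (G 0))
    (fun i => Fin.cons 0 fun k => G i.succ k - G i.castSucc k) i) (fun _ => 1)]
  · rw [det_succ_column_zero, Fin.sum_univ_succ]
    simp [submatrix]
  · simp
  · intro i j
    cases j using Fin.cases <;> simp

theorem sum_det_interlacing {a : Fin (m + 1) → ℤ} (ha : Monotone a)
    (heven : ∀ i j, Even (a i - a j)) {g G : Fin m → ℤ → R}
    (hG : ∀ k c, G k (c + 2) = G k c + g k (c + 1)) :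
    ∑ d ∈ interlacing a, (of fun i k => g k (d i)).det =
      (of fun i => (Fin.cons 1 fun k => G k (a i) : Fin (m + 1) → R)).det := by
  have telescope (i k : Fin m) : ∑ c ∈ colsBetween (a i.castSucc) (a i.succ), g k c =
      G k (a i.succ) - G k (a i.castSucc) := by
    have := eq_sum_colsBetween_add (f := fun c => -G k c) (g := g k)
      (ha i.castSucc_lt_succ.le) (heven _ _) fun c _ _ _ => by grind
    grind
  rw [← det_consecutive_differences fun i k => G k (a i)]
  refine ((detRowAlternating (n := Fin m) (R := R)).toMultilinearMap.map_sum_finset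
    (fun _ c k => g k c) fun i => colsBetween (a i.castSucc) (a i.succ)).symm.trans ?_
  refine congrArg det (Matrix.ext fun i k => ?_)
  rw [Finset.sum_apply, of_apply, telescope]

theorem sum_det_interlacing_vecCons_zero {c : Fin m → ℤ} (hc : Monotone (vecCons 0 c))
    (heven : ∀ i, Even (c i)) {g G : Fin m → ℤ → R}
    (hG : ∀ k c, G k (c + 2) = G k c + g k (c + 1)) (hG0 : ∀ k, G k 0 = 0) :
    ∑ d ∈ interlacing (vecCons 0 c), (of fun i k => g k (d i)).det =
      (of fun i k => G k (c i)).det := by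
  rw [sum_det_interlacing hc (fun i j => ?_) hG, det_succ_row_zero, Fin.sum_univ_succ]
  · simp [hG0, submatrix]
  · cases i using Fin.cases <;> cases j using Fin.cases <;> simp [heven, Int.even_sub]

end CommRing

section Hyperbolic

variable {K : Type*} [Field K] {q : K} {m : ℕ}

/-- The Vandermonde determinant in the variables `q ^ (2 c) + q ^ (-2 c)`. -/
noncomputable def colVandermonde (q : K) (c : Fin m → ℤ) : K :=
  (vandermonde fun i => qSum q (2 * c i)).det

theorem det_qSum_even (hq : q ≠ 0) (c : Fin (m + 1) → ℤ) :
    (of fun i => (Fin.cons 1 fun k : Fin m => qSum q (2 * (k + 1) * c i) :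
      Fin (m + 1) → K)).det = colVandermonde q c := by
  have h := det_of_threeTermRecursion 1 (fun i => qSum q (2 * c i))
    (fun k i => if k = 0 then 1 else qSum q (2 * k * c i)) 0 (fun k => if k = 0 then 2 else 1)
    (by simp) (by simp) fun k i => ?_
  · simp only [Pi.one_apply, Finset.prod_const_one, one_mul] at h
    rw [colVandermonde, ← h]
    congr! with i j
    cases j using Fin.cases <;> simp
  · rw [if_neg (by simp), if_neg (by simp), qSum_mul_qSum hq]
    rcases k with _ | k
    · simp only [zero_add, Nat.cast_ofNat, Nat.cast_one, mul_one, sub_self, qSum_zero, if_true]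
      ring_nf
    · simp only [Nat.add_eq_zero_iff, one_ne_zero, and_false, if_false]
      push_cast
      ring_nf

theorem det_qDiff_even (hq : q ≠ 0) (c : Fin m → ℤ) :
    (of fun i k : Fin m => qDiff q (2 * (k + 1) * c i)).det =
      (∏ i, qDiff q (2 * c i)) * colVandermonde q c := by
  refine det_of_threeTermRecursion _ _ (fun k i => qDiff q (2 * (k + 1) * c i)) 0 1
    (by simp) (fun i => ?_) fun k i => ?_
  · rw [add_zero, mul_comm (qDiff q _), qSum_mul_qDiff_self hq]
    ring_nf
  · rw [qSum_mul_qDiff hq, Pi.one_apply]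
    push_cast
    ring_nf

theorem det_qSum_odd (hq : q ≠ 0) (c : Fin m → ℤ) :
    (of fun i k : Fin m => qSum q ((2 * k + 1) * c i)).det =
      (∏ i, qSum q (c i)) * colVandermonde q c := by
  refine det_of_threeTermRecursion _ _ (fun k i => qSum q ((2 * k + 1) * c i)) (-1) 1
    (by simp) (fun i => ?_) fun k i => ?_
  · rw [mul_add, qSum_mul_qSum hq]
    ring_nf
  · rw [qSum_mul_qSum hq, Pi.one_apply]
    push_cast
    ring_nf

theorem det_qDiff_odd (hq : q ≠ 0) (c : Fin m → ℤ) :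
    (of fun i k : Fin m => qDiff q ((2 * k + 1) * c i)).det =
      (∏ i, qDiff q (c i)) * colVandermonde q c := by
  refine det_of_threeTermRecursion _ _ (fun k i => qDiff q ((2 * k + 1) * c i)) 1 1
    (by simp) (fun i => ?_) fun k i => ?_
  · rw [mul_add, qDiff_mul_qSum hq]
    ring_nf
  · rw [qSum_mul_qDiff hq, Pi.one_apply]
    push_cast
    ring_nf

end Hyperbolic

end Determinants

section Summation

variable {K : Type*} [Field K] {q : K} {m : ℕ}

theorem sum_interlacing_qDiff_mul_colVandermonde (hq : q ≠ 0) {a : Fin (m + 1) → ℤ}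
    (ha : Monotone a) (heven : ∀ i j, Even (a i - a j)) :
    (∏ k : Fin m, qDiff q (2 * (k + 1))) * ∑ d ∈ interlacing a,
      (∏ i, qSum q (d i)) * ((∏ i, qDiff q (d i)) * colVandermonde q d) =
      colVandermonde q a := by
  rw [← det_qSum_even hq, ← sum_det_interlacing ha heven
    (g := fun k c => qDiff q (2 * (k + 1)) * qDiff q (2 * (k + 1) * c))
    (G := fun k c => qSum q (2 * (k + 1) * c)), Finset.mul_sum]
  · refine Finset.sum_congr rfl fun d _ => ?_
    refine Eq.trans ?_ (Matrix.det_mul_row (fun k : Fin m => qDiff q (2 * (k + 1)))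
      (.of fun i (k : Fin m) => qDiff q (2 * (k + 1) * d i))).symm
    rw [det_qDiff_even hq, ← mul_assoc (∏ i, qSum q _), ← Finset.prod_mul_distrib]
    simp only [qSum_mul_qDiff_self hq]
  · intro k c
    rw [qDiff_mul_qDiff hq]
    ring_nf

theorem sum_interlacing_vecCons_zero_colVandermonde (hq : q ≠ 0) {c : Fin m → ℤ}
    (hc : Monotone (Matrix.vecCons 0 c)) (heven : ∀ i, Even (c i)) :
    (∏ k : Fin m, qDiff q (2 * k + 1)) * ∑ d ∈ interlacing (Matrix.vecCons 0 c),
      (∏ i, qSum q (d i)) * colVandermonde q d = (∏ i, qDiff q (c i)) * colVandermonde q c := by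
  rw [← det_qDiff_odd hq, ← sum_det_interlacing_vecCons_zero hc heven
    (g := fun k c => qDiff q (2 * k + 1) * qSum q ((2 * k + 1) * c))
    (G := fun k c => qDiff q ((2 * k + 1) * c)), Finset.mul_sum]
  · refine Finset.sum_congr rfl fun d _ => ?_
    rw [← det_qSum_odd hq]
    exact (Matrix.det_mul_row (fun k : Fin m => qDiff q (2 * k + 1))
      (.of fun i (k : Fin m) => qSum q ((2 * k + 1) * d i))).symm
  · intro k c
    rw [qDiff_mul_qSum hq]
    ring_nf
  · simp

end Summation

section ProductFormula

variable {K : Type*} [Field K] (q : K)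

/-- The factorial of the hyperbolic sines, `qDiff q 1 * ⋯ * qDiff q m`. -/
def qDiffFactorial (m : ℕ) : K := ∏ k ∈ Finset.range m, qDiff q (k + 1)

theorem qDiffFactorial_odd (m : ℕ) :
    qDiffFactorial q (2 * m + 1) =
      (∏ k : Fin m, qDiff q (2 * (k + 1))) * ∏ k : Fin (m + 1), qDiff q (2 * k + 1) := by
  induction m with
  | zero => simp [qDiffFactorial]
  | succ m ih =>
    rw [qDiffFactorial] at ih ⊢
    rw [show 2 * (m + 1) + 1 = 2 * m + 1 + 1 + 1 by ring, Finset.prod_range_succ,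
      Finset.prod_range_succ, ih,
      Fin.prod_univ_castSucc fun k : Fin (m + 1) => qDiff q (2 * ((k : ℕ) + 1)),
      Fin.prod_univ_castSucc fun k : Fin (m + 2) => qDiff q (2 * (k : ℕ) + 1)]
    simp only [Fin.val_castSucc, Fin.val_last]
    push_cast
    ring_nf

variable {q} {N H : ℤ}

theorem tilingGF_dentedRegion_self {a : Fin 0 → ℤ} : tilingGF q (dentedRegion N H H a) = 1 := by
  simp [dentedRegion, rowRegion, tilingGF_empty]

/-- Two rows at a time: the row of even height contributes the factors `qDiff q (2 k + 1)` and the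
row of odd height the factors `qDiff q (2 (k + 1))`. -/
theorem tilingGF_dentedRegion (h2 : (2 : K) ≠ 0) (hq : q ≠ 0) (hN : Even N) {m : ℕ} {r : ℤ}
    (hr : Even r) (hH : r + 2 * m = H) {a : Fin m → ℤ}
    (ha : IsDentRow N r (Matrix.vecCons 0 a)) :
    2 ^ m ^ 2 * (∏ i ∈ Finset.range m, qDiffFactorial q (2 * i + 1)) *
      tilingGF q (dentedRegion N H r a) = (∏ i, qDiff q (a i)) * colVandermonde q a := by
  induction m generalizing r with
  | zero =>
    obtain rfl : r = H := by simpa using hH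
    simp [tilingGF_dentedRegion_self, colVandermonde]
  | succ m ih =>
    push_cast at hH
    have row_odd : ∀ d ∈ interlacing (Matrix.vecCons 0 a),
        2 ^ (m ^ 2 + m) * (∏ i ∈ Finset.range m, qDiffFactorial q (2 * i + 1)) *
          (∏ k : Fin m, qDiff q (2 * (k + 1))) * tilingGF q (dentedRegion N H (r + 1) d) =
          colVandermonde q d := by
      intro d hd
      have hd' := ha.of_mem_interlacing hd
      rw [tilingGF_dentedRegion_of_odd q hN hr.add_one (by lia) hd',
        ← sum_interlacing_qDiff_mul_colVandermonde hq hd'.strictMono.monotone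
          fun i j => by grind [hd'.even i, hd'.even j], Finset.mul_sum, Finset.mul_sum]
      refine Finset.sum_congr rfl fun e he => ?_
      rw [← ih (by grind) (by lia) (hd'.vecCons_zero_of_mem_interlacing hr.add_one he),
        Finset.prod_div_distrib, Finset.prod_const, Finset.card_fin, pow_add]
      field_simp
    rw [tilingGF_dentedRegion_of_even q hN (by lia) ha,
      ← sum_interlacing_vecCons_zero_colVandermonde hq ha.strictMono.monotone
        fun i => by grind [ha.even i.succ, Matrix.cons_val_succ], Finset.mul_sum, Finset.mul_sum]
    refine Finset.sum_congr rfl fun d hd => ?_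
    rw [← row_odd d hd, Finset.prod_range_succ, qDiffFactorial_odd, Finset.prod_div_distrib,
      Finset.prod_const, Finset.card_fin, show (m + 1) ^ 2 = m ^ 2 + m + (m + 1) by ring, pow_add]
    field_simp

theorem mem_trapezoid {x n : ℕ} {c r : ℤ} :
    (c, r) ∈ trapezoid x n ↔ 1 ≤ c ∧ 0 ≤ r ∧ r < 2 * n ∧ c + r ≤ 2 * (x + n) := by
  simp only [trapezoid, Finset.mem_filter, Finset.mem_product, Finset.mem_Icc]
  by_cases h : IsUp (c, r)
  · simp only [vertices, h, if_true, Finset.mem_insert, Finset.mem_singleton, forall_eq_or_imp,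
      forall_eq]
    grind
  · simp only [vertices, h, if_false, Finset.mem_insert, Finset.mem_singleton, forall_eq_or_imp,
      forall_eq]
    grind [IsUp]

theorem quarteredHexagon_eq_dentedRegion (x n : ℕ) (s : Fin n → ℕ) :
    quarteredHexagon x n s = dentedRegion (2 * (x + n)) (2 * n) 0 fun i => 2 * (s i : ℤ) := by
  ext ⟨c, r⟩
  simp only [quarteredHexagon, dentedRegion, Finset.mem_sdiff, mem_trapezoid, mem_rowRegion]
  grind

theorem isDentRow_two_mul {x n : ℕ} {s : Fin n → ℕ} (hs : StrictMono s) (hpos : ∀ i, 1 ≤ s i)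
    (hle : ∀ i, s i ≤ n + x) :
    IsDentRow (2 * (x + n)) 0 (Matrix.vecCons 0 fun i => 2 * (s i : ℤ)) := by
  refine ⟨Fin.strictMono_cons.mpr ⟨fun i => ?_, fun i j hij => ?_⟩, ?_, ?_, ?_⟩
  · grind
  · grind [hs hij]
  all_goals rw [Fin.forall_fin_succ]
  · simp
  · simp
  · simp only [Matrix.cons_val_zero, Matrix.cons_val_succ]
    grind

end ProductFormula

section QIntegers

variable {K : Type*} [Field K] {q : K} {n : ℕ} {s : Fin n → ℕ}

theorem qInt_sq_mul_qDiff_one (hq : q ≠ 0) (m : ℕ) :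
    qInt (q ^ 2) m * qDiff q 1 = q ^ (m - 1 : ℤ) * qDiff q m := by
  have geom : qInt (q ^ 2) m * (q ^ 2 - 1) = (q ^ 2) ^ m - 1 := geom_sum_mul _ _
  apply mul_left_cancel₀ hq
  calc q * (qInt (q ^ 2) m * qDiff q 1) = qInt (q ^ 2) m * (q ^ 2 - 1) := by
        rw [qDiff]
        field_simp
    _ = (q ^ 2) ^ m - 1 := geom
    _ = q * (q ^ (m - 1 : ℤ) * qDiff q m) := by
        rw [qDiff, zpow_sub_one₀ hq, zpow_neg, zpow_natCast, pow_right_comm]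
        field_simp

theorem qInt_sq_mul_qInt_sq_mul_qDiff_one_sq (hq : q ≠ 0) {s t : ℕ} (h : s ≤ t) :
    qInt (q ^ 2) (2 * (s + t)) * qInt (q ^ 2) (2 * (t - s)) * qDiff q 1 ^ 2 =
      (q ^ (2 * t - 1 : ℤ)) ^ 2 * (qSum q (2 * (2 * t)) - qSum q (2 * (2 * s))) := by
  rw [sq (qDiff q 1), mul_mul_mul_comm, qInt_sq_mul_qDiff_one hq, qInt_sq_mul_qDiff_one hq,
    mul_mul_mul_comm, qDiff_mul_qDiff hq, ← zpow_add₀ hq, sq (q ^ _), ← zpow_add₀ hq]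
  push_cast [h]
  rw [← qSum_neg q (2 * (t - s) - 2 * (s + t))]
  ring_nf

theorem qFactorial_sq_mul_qDiff_one_pow (hq : q ≠ 0) (j : ℕ) :
    qFactorial (q ^ 2) (2 * j + 1) * qDiff q 1 ^ (2 * j + 1) =
      q ^ (j * (2 * j + 1)) * qDiffFactorial q (2 * j + 1) := by
  have exponent : ∑ k ∈ Finset.range (2 * j + 1), k = j * (2 * j + 1) := by
    rw [Finset.sum_range_id, Nat.add_sub_cancel, mul_comm, mul_assoc,
      Nat.mul_div_cancel_left _ two_pos]
  rw [← exponent, ← Finset.prod_pow_eq_pow_sum, qFactorial, qDiffFactorial,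
    ← Finset.card_range (2 * j + 1), ← Finset.prod_const, Finset.card_range,
    ← Finset.prod_mul_distrib, ← Finset.prod_mul_distrib]
  refine Finset.prod_congr rfl fun k _ => ?_
  rw [qInt_sq_mul_qDiff_one hq]
  simp

theorem prod_Ioi_eq_prod_Iio {M : Type*} [CommMonoid M] (f : Fin n → Fin n → M) :
    ∏ i, ∏ j ∈ Finset.Ioi i, f i j = ∏ j, ∏ i ∈ Finset.Iio j, f i j :=
  Finset.prod_comm' (by simp)

theorem prod_Ici_eq_prod_Iic {M : Type*} [CommMonoid M] (f : Fin n → Fin n → M) :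
    ∏ i, ∏ j ∈ Finset.Ici i, f i j = ∏ j, ∏ i ∈ Finset.Iic j, f i j :=
  Finset.prod_comm' (by simp)

theorem prod_Ioi_eq_prod_pow {M : Type*} [CommMonoid M] (f : Fin n → M) :
    ∏ i, ∏ j ∈ Finset.Ioi i, f j = ∏ j, f j ^ (j : ℕ) := by
  simp only [prod_Ioi_eq_prod_Iio, Finset.prod_const, Fin.card_Iio]

theorem prod_qInt_sq_mul_prod_qDiff_one_pow (hq : q ≠ 0) (hs : Monotone s) :
    (∏ i, qInt (q ^ 2) (2 * s i)) * (∏ i, ∏ j ∈ Finset.Ioi i,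
      qInt (q ^ 2) (2 * (s i + s j)) * qInt (q ^ 2) (2 * (s j - s i))) *
        ∏ i : Fin n, qDiff q 1 ^ (2 * (i : ℕ) + 1) =
    (∏ i : Fin n, (q ^ (2 * s i - 1 : ℤ)) ^ (2 * (i : ℕ) + 1)) *
      ((∏ i, qDiff q (2 * s i)) * colVandermonde q fun i => 2 * (s i : ℤ)) := by
  have diagonal : (∏ i, qInt (q ^ 2) (2 * s i)) * ∏ _i : Fin n, qDiff q 1 =
      (∏ i, q ^ (2 * s i - 1 : ℤ)) * ∏ i, qDiff q (2 * s i) := by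
    simp only [← Finset.prod_mul_distrib, qInt_sq_mul_qDiff_one hq]
    push_cast
    rfl
  have off_diagonal : (∏ i, ∏ j ∈ Finset.Ioi i,
      qInt (q ^ 2) (2 * (s i + s j)) * qInt (q ^ 2) (2 * (s j - s i))) *
        ∏ i : Fin n, (qDiff q 1 ^ 2) ^ (i : ℕ) =
      (∏ i : Fin n, ((q ^ (2 * s i - 1 : ℤ)) ^ 2) ^ (i : ℕ)) *
        colVandermonde q fun i => 2 * (s i : ℤ) := by
    rw [colVandermonde, Matrix.det_vandermonde, ← prod_Ioi_eq_prod_pow, ← prod_Ioi_eq_prod_pow]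
    simp only [← Finset.prod_mul_distrib]
    exact Finset.prod_congr rfl fun i _ => Finset.prod_congr rfl fun j hj =>
      qInt_sq_mul_qInt_sq_mul_qDiff_one_sq hq (hs (Finset.mem_Ioi.mp hj).le)
  simp only [pow_succ, pow_mul, Finset.prod_mul_distrib] at diagonal off_diagonal ⊢
  linear_combination congr($diagonal * $off_diagonal)

theorem zpow_sum {ι : Type*} (hq : q ≠ 0) (t : Finset ι) (f : ι → ℤ) :
    q ^ ∑ i ∈ t, f i = ∏ i ∈ t, q ^ f i := by
  induction t using Finset.cons_induction with
  | empty => simp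
  | cons i t hi ih => rw [Finset.sum_cons, Finset.prod_cons, zpow_add₀ hq, ih]

theorem zpow_qExponent_mul (hq : q ≠ 0) (s : Fin n → ℕ) :
    q ^ qExponent n s * ∏ i : Fin n, q ^ ((i : ℕ) * (2 * (i : ℕ) + 1)) =
      ∏ i : Fin n, (q ^ (2 * s i - 1 : ℤ)) ^ (2 * (i : ℕ) + 1) := by
  rw [qExponent, zpow_sum hq, ← Finset.prod_mul_distrib]
  refine Finset.prod_congr rfl fun i _ => ?_
  rw [← zpow_natCast, ← zpow_natCast, ← zpow_mul, ← zpow_add₀ hq]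
  push_cast
  ring_nf

theorem prod_Iio_val {M : Type*} [CommMonoid M] (j : Fin n) (f : ℕ → M) :
    ∏ i ∈ Finset.Iio j, f i = ∏ i ∈ Finset.range j, f i := by
  rw [← Nat.Iio_eq_range, ← Fin.map_valEmbedding_Iio, Finset.prod_map]
  rfl

theorem prod_Iic_val {M : Type*} [CommMonoid M] (j : Fin n) (f : ℕ → M) :
    ∏ i ∈ Finset.Iic j, f i = ∏ i ∈ Finset.range (j + 1), f i := by
  rw [Nat.range_succ_eq_Iic, ← Fin.map_valEmbedding_Iic, Finset.prod_map]
  rfl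

theorem qFactorial_add (p : K) (j k : ℕ) :
    qFactorial p (j + k) =
      (∏ i ∈ Finset.range j, qInt p (j - i)) * ∏ i ∈ Finset.range k, qInt p (i + j + 1) := by
  rw [qFactorial, Finset.prod_range_add, ← Finset.prod_range_reflect]
  congr 1 <;> refine Finset.prod_congr rfl fun i hi => ?_
  · rw [Finset.mem_range] at hi
    congr 1
    lia
  · rw [add_comm j]

theorem prod_qFactorial_odd (p : K) (n : ℕ) :
    ∏ i : Fin n, qFactorial p (2 * (i : ℕ) + 1) =
      (∏ i : Fin n, ∏ j ∈ Finset.Ici i, qInt p ((i : ℕ) + (j : ℕ) + 1)) *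
        ∏ i : Fin n, ∏ j ∈ Finset.Ioi i, qInt p ((j : ℕ) - (i : ℕ)) := by
  rw [prod_Ioi_eq_prod_Iio, prod_Ici_eq_prod_Iic, ← Finset.prod_mul_distrib]
  refine Finset.prod_congr rfl fun j _ => ?_
  rw [prod_Iic_val j fun i => qInt p (i + j + 1), prod_Iio_val j fun i => qInt p (j - i),
    two_mul, add_assoc, qFactorial_add, mul_comm]

theorem qInt_two_mul_add_self (p : K) (k : ℕ) :
    qInt p (2 * (k + k)) = (p ^ (2 * k) + 1) * qInt p (2 * k) := by
  rw [mul_add, qInt, Finset.sum_range_add, add_comm, add_one_mul, qInt, Finset.mul_sum]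
  simp only [pow_add]

theorem prod_qInt_div_prod_qFactorial_odd {p : K} (h : ∀ i, p ^ (2 * s i) + 1 ≠ 0) :
    ((∏ i, qInt p (2 * s i)) *
      ∏ i, ∏ j ∈ Finset.Ioi i, qInt p (2 * (s i + s j)) * qInt p (2 * (s j - s i))) /
        ∏ i : Fin n, qFactorial p (2 * (i : ℕ) + 1) =
    (∏ i, 1 / (p ^ (2 * s i) + 1)) *
      (∏ i, ∏ j ∈ Finset.Ici i, qInt p (2 * (s i + s j)) / qInt p ((i : ℕ) + (j : ℕ) + 1)) *
      ∏ i, ∏ j ∈ Finset.Ioi i, qInt p (2 * (s j - s i)) / qInt p ((j : ℕ) - (i : ℕ)) := by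
  have diagonal (i : Fin n) :
      qInt p (2 * s i) = 1 / (p ^ (2 * s i) + 1) * qInt p (2 * (s i + s i)) := by
    rw [qInt_two_mul_add_self, one_div, inv_mul_cancel_left₀ (h i)]
  rw [prod_qFactorial_odd, Finset.prod_congr rfl fun i _ => diagonal i]
  simp only [Finset.prod_div_distrib, Finset.prod_mul_distrib, ← Finset.mul_prod_Ioi_eq_prod_Ici]
  ring

end QIntegers

section TilingFormula

variable {K : Type*} [Field K] {q : K}

theorem pow_add_one_ne_zero (hroot : ¬ IsOfFinOrder q) {k : ℕ} (hk : k ≠ 0) : q ^ k + 1 ≠ 0 :=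
  fun h => hroot <| isOfFinOrder_iff_pow_eq_one.mpr ⟨2 * k, by lia, by
    rw [mul_comm, pow_mul, eq_neg_of_add_eq_zero_left h, neg_one_sq]⟩

theorem qDiff_ne_zero (hq : q ≠ 0) (hroot : ¬ IsOfFinOrder q) {k : ℕ} (hk : k ≠ 0) :
    qDiff q k ≠ 0 :=
  fun h => hroot <| isOfFinOrder_iff_pow_eq_one.mpr ⟨2 * k, by lia, by
    rw [qDiff, sub_eq_zero, zpow_neg, zpow_natCast] at h
    rw [two_mul, pow_add, (mul_eq_one_iff_eq_inv₀ (pow_ne_zero k hq)).mpr h]⟩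

theorem qDiffFactorial_ne_zero (hq : q ≠ 0) (hroot : ¬ IsOfFinOrder q) (m : ℕ) :
    qDiffFactorial q m ≠ 0 :=
  Finset.prod_ne_zero_iff.mpr fun k _ => mod_cast qDiff_ne_zero hq hroot k.succ_ne_zero

theorem tilingGF_quarteredHexagon (h2 : (2 : K) ≠ 0) (hq : q ≠ 0) {x n : ℕ} {s : Fin n → ℕ}
    (hs : StrictMono s) (hpos : ∀ i, 1 ≤ s i) (hle : ∀ i, s i ≤ n + x) :
    2 ^ n ^ 2 * (∏ i : Fin n, qDiffFactorial q (2 * (i : ℕ) + 1)) *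
      tilingGF q (quarteredHexagon x n s) =
      (∏ i, qDiff q (2 * s i)) * colVandermonde q fun i => 2 * (s i : ℤ) := by
  rw [quarteredHexagon_eq_dentedRegion,
    ← tilingGF_dentedRegion h2 hq (even_two_mul _) .zero (zero_add _)
      (isDentRow_two_mul hs hpos hle), Finset.prod_range]

theorem tilingGF_quarteredHexagon_eq_prod_qInt_div (h2 : (2 : K) ≠ 0) (hq : q ≠ 0)
    (hroot : ¬ IsOfFinOrder q) {x n : ℕ} {s : Fin n → ℕ} (hs : StrictMono s)
    (hpos : ∀ i, 1 ≤ s i) (hle : ∀ i, s i ≤ n + x) :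
    tilingGF q (quarteredHexagon x n s) = (2 ^ n ^ 2)⁻¹ * q ^ (-qExponent n s) *
      (((∏ i, qInt (q ^ 2) (2 * s i)) * ∏ i, ∏ j ∈ Finset.Ioi i,
        qInt (q ^ 2) (2 * (s i + s j)) * qInt (q ^ 2) (2 * (s j - s i))) /
          ∏ i : Fin n, qFactorial (q ^ 2) (2 * (i : ℕ) + 1)) := by
  have numerator := prod_qInt_sq_mul_prod_qDiff_one_pow hq hs.monotone
  have denominator : (∏ i : Fin n, qFactorial (q ^ 2) (2 * (i : ℕ) + 1)) *
      ∏ i : Fin n, qDiff q 1 ^ (2 * (i : ℕ) + 1) =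
      (∏ i : Fin n, q ^ ((i : ℕ) * (2 * (i : ℕ) + 1))) *
        ∏ i : Fin n, qDiffFactorial q (2 * (i : ℕ) + 1) := by
    simp only [← Finset.prod_mul_distrib, qFactorial_sq_mul_qDiff_one_pow hq]
  have scale_ne_zero : ∏ i : Fin n, qDiff q 1 ^ (2 * (i : ℕ) + 1) ≠ 0 :=
    Finset.prod_ne_zero_iff.mpr fun i _ => pow_ne_zero _ (qDiff_ne_zero hq hroot one_ne_zero)
  have denominator_ne_zero : ∏ i : Fin n, qFactorial (q ^ 2) (2 * (i : ℕ) + 1) ≠ 0 := by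
    refine left_ne_zero_of_mul (denominator.trans_ne (mul_ne_zero ?_ ?_)) <;>
      refine Finset.prod_ne_zero_iff.mpr fun i _ => ?_
    exacts [pow_ne_zero _ hq, qDiffFactorial_ne_zero hq hroot _]
  rw [← zpow_qExponent_mul hq, ← tilingGF_quarteredHexagon h2 hq hs hpos hle] at numerator
  rw [mul_div_assoc', eq_div_iff denominator_ne_zero, zpow_neg, ← mul_inv,
    eq_inv_mul_iff_mul_eq₀ (mul_ne_zero (pow_ne_zero _ h2) (zpow_ne_zero _ hq))]
  apply mul_right_cancel₀ scale_ne_zero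
  rw [numerator]
  linear_combination 2 ^ n ^ 2 * q ^ qExponent n s * tilingGF q (quarteredHexagon x n s) *
    denominator

theorem ratFuncX_not_isOfFinOrder {F : Type*} [Field F] :
    ¬ IsOfFinOrder (RatFunc.X : RatFunc F) := by
  rw [isOfFinOrder_iff_pow_eq_one]
  rintro ⟨k, hk, h⟩
  exact RatFunc.transcendental_X.pow hk (h ▸ isAlgebraic_one)

end TilingFormula

end QuarteredHexagon

theorem mainTheorem4_general {K : Type*} [Field K] (h2 : (2 : K) ≠ 0) (q : K) (hq : q ≠ 0)
    (hroot : ¬ IsOfFinOrder q) (x n : ℕ) (s : Fin n → ℕ) (hs : StrictMono s)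
    (hpos : ∀ i, 1 ≤ s i) (hle : ∀ i, s i ≤ n + x) :
    QuarteredHexagon.tilingGF q (QuarteredHexagon.quarteredHexagon x n s) =
        ((2 : K) ^ (n ^ 2))⁻¹ * q ^ (-QuarteredHexagon.qExponent n s) *
          (((∏ i : Fin n, QuarteredHexagon.qInt (q ^ 2) (2 * s i)) *
              ∏ i : Fin n, ∏ j ∈ Finset.Ioi i,
                QuarteredHexagon.qInt (q ^ 2) (2 * (s i + s j)) *
                  QuarteredHexagon.qInt (q ^ 2) (2 * (s j - s i))) /
            ∏ i : Fin n, QuarteredHexagon.qFactorial (q ^ 2) (2 * (i : ℕ) + 1)) ∧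
    QuarteredHexagon.tilingGF q (QuarteredHexagon.quarteredHexagon x n s) =
        ((2 : K) ^ (n ^ 2))⁻¹ * q ^ (-QuarteredHexagon.qExponent n s) *
          (∏ i : Fin n, 1 / (q ^ (4 * s i) + 1)) *
          (∏ i : Fin n, ∏ j ∈ Finset.Ici i,
            QuarteredHexagon.qInt (q ^ 2) (2 * (s i + s j)) /
              QuarteredHexagon.qInt (q ^ 2) ((i : ℕ) + (j : ℕ) + 1)) *
          (∏ i : Fin n, ∏ j ∈ Finset.Ioi i,
            QuarteredHexagon.qInt (q ^ 2) (2 * (s j - s i)) /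
              QuarteredHexagon.qInt (q ^ 2) ((j : ℕ) - (i : ℕ))) := by
  have first_formula := QuarteredHexagon.tilingGF_quarteredHexagon_eq_prod_qInt_div h2 hq hroot
    hs hpos hle
  have sq_pow (i : Fin n) : (q ^ 2) ^ (2 * s i) = q ^ (4 * s i) := by
    rw [← pow_mul]
    ring
  have pow_add_one (i : Fin n) : (q ^ 2) ^ (2 * s i) + 1 ≠ 0 := by
    rw [sq_pow]
    exact QuarteredHexagon.pow_add_one_ne_zero hroot (by grind)
  refine ⟨first_formula, first_formula.trans ?_⟩
  rw [QuarteredHexagon.prod_qInt_div_prod_qFactorial_odd pow_add_one]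
  simp only [sq_pow, mul_assoc]

/-- `q` is the indeterminate of the field `ℚ(q)`. The indices `1 ≤ i, j ≤ n` of the formulas are
`(i : Fin n) + 1`, `(j : Fin n) + 1`; so `2i - 1`, `i + j - 1`, `j - i` become `2 * i + 1`,
`i + j + 1`, `j - i`. All subtractions of natural numbers below are of a smaller number from a
larger one. -/
theorem mainTheorem4 (x n : ℕ) (s : Fin n → ℕ) (hs : StrictMono s)
    (hpos : ∀ i, 1 ≤ s i) (hle : ∀ i, s i ≤ n + x)
    (q : RatFunc ℚ) (hq : q = RatFunc.X) :
    QuarteredHexagon.tilingGF q (QuarteredHexagon.quarteredHexagon x n s) =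
        ((2 : RatFunc ℚ) ^ (n ^ 2))⁻¹ * q ^ (-QuarteredHexagon.qExponent n s) *
          (((∏ i : Fin n, QuarteredHexagon.qInt (q ^ 2) (2 * s i)) *
              ∏ i : Fin n, ∏ j ∈ Finset.Ioi i,
                QuarteredHexagon.qInt (q ^ 2) (2 * (s i + s j)) *
                  QuarteredHexagon.qInt (q ^ 2) (2 * (s j - s i))) /
            ∏ i : Fin n, QuarteredHexagon.qFactorial (q ^ 2) (2 * (i : ℕ) + 1)) ∧
    QuarteredHexagon.tilingGF q (QuarteredHexagon.quarteredHexagon x n s) =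
        ((2 : RatFunc ℚ) ^ (n ^ 2))⁻¹ * q ^ (-QuarteredHexagon.qExponent n s) *
          (∏ i : Fin n, 1 / (q ^ (4 * s i) + 1)) *
          (∏ i : Fin n, ∏ j ∈ Finset.Ici i,
            QuarteredHexagon.qInt (q ^ 2) (2 * (s i + s j)) /
              QuarteredHexagon.qInt (q ^ 2) ((i : ℕ) + (j : ℕ) + 1)) *
          (∏ i : Fin n, ∏ j ∈ Finset.Ioi i,
            QuarteredHexagon.qInt (q ^ 2) (2 * (s j - s i)) /
              QuarteredHexagon.qInt (q ^ 2) ((j : ℕ) - (i : ℕ))) := by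
  subst hq
  exact mainTheorem4_general two_ne_zero _ RatFunc.X_ne_zero
    QuarteredHexagon.ratFuncX_not_isOfFinOrder x n s hs hpos hle
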